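/- **Theorem 2 (BMM-hardness of inclusion-based points-to analysis).** For any fixed $\delta>0$, if there is a combinatorial algorithm that solves inclusion-based (Andersen-style) points-to analysis in $O(n^{3-\delta})$ time, where $n$ is the number of program variables, then there is a combinatorial algorithm that multiplies two $n\times n$ Boolean matrices in truly subcubic time, i.e. in time $O(n^{3-\varepsilon})$ for some $\varepsilon>0$. Here: - *Boolean matrix multiplication* is the computation of $c_{ij}=\bigvee_{k}(a_{ik}\wedge b_{kj})$ for all $i,j$. - *Inclusion-based points-to analysis* takes a normalized program, that is, a finite set of statements of the forms `a = &b`, `a = b`, `a = *b`, `*a = b` over $n$ variables, listed in any order without repetition. Let $\mathrm{pt}$ be the least family of sets of variables that satisfies the constraints $b\in \mathrm{pt}(a)$; $\mathrm{pt}(b)\subseteq \mathrm{pt}(a)$; $\forall v\in \mathrm{pt}(b):\mathrm{pt}(v)\subseteq \mathrm{pt}(a)$; $\forall v\in \mathrm{pt}(a):\mathrm{pt}(b)\subseteq \mathrm{pt}(v)$ of these statements, respectively. The task is to decide for all pairs of variables $p,q$ whether $q\in \mathrm{pt}(p)$. - Algorithms are programs of a unit-cost RAM with $O(\log n)$-bit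 words. - "Combinatorial" is an informal term. The theorem holds for every reading of it as a class of programs that contains all elementary linear-time programs and is closed under sequential composition. An elementary linear-time program uses no word operations but addition and subtraction (besides data movement and comparisons of words); whatever the registers and the memory contain otherwise, it runs in time linear in the length of the list it is given, leaves a list of linear length, and lengthens the words by at most a constant factor. -/

import Mathlib

/-! ### Word RAM

Programs of a unit-cost random access machine, with structured control flow: finitely many
registers (numbered by `ℕ`), an addressable memory, the usual word operations, and branching and
looping on comparisons of registers. -/

namespace PointsToBMM

/-- Binary word operations. -/
inductive Op where
  | add | sub | mul | div | mod | bitAnd | bitOr | bitXor | shiftLeft | shiftRight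

/-- Value of a word operation (natural numbers; `sub` is truncated at `0`). -/
def Op.eval : Op → ℕ → ℕ → ℕ
  | .add, a, b => a + b
  | .sub, a, b => a - b
  | .mul, a, b => a * b
  | .div, a, b => a / b
  | .mod, a, b => a % b
  | .bitAnd, a, b => a &&& b
  | .bitOr, a, b => a ||| b
  | .bitXor, a, b => a ^^^ b
  | .shiftLeft, a, b => a <<< b
  | .shiftRight, a, b => a >>> b

/-- Programs. Every natural number argument except the `k` of `const` is the number of a register. -/
inductive Program where
  /-- do nothing -/
  | skip
  /-- `r := k` -/
  | const (r k : ℕ)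
  /-- `r := x` -/
  | copy (r x : ℕ)
  /-- `r := x o y` -/
  | op (o : Op) (r x y : ℕ)
  /-- `r := memory[x]` -/
  | load (r x : ℕ)
  /-- `memory[x] := y` -/
  | store (x y : ℕ)
  /-- first `p`, then `q` -/
  | seq (p q : Program)
  /-- `if x < y then p else q` -/
  | ifLt (x y : ℕ) (p q : Program)
  /-- `while x < y do p` -/
  | whileLt (x y : ℕ) (p : Program)

/-- Contents of the registers and of the memory. -/
structure State where
  reg : ℕ → ℕ
  mem : ℕ → ℕ

/-- The state in which register `r` has been overwritten by `v`. -/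
def State.setReg (s : State) (r v : ℕ) : State := ⟨Function.update s.reg r v, s.mem⟩

/-- The state in which memory cell `a` has been overwritten by `v`. -/
def State.setMem (s : State) (a v : ℕ) : State := ⟨s.reg, Function.update s.mem a v⟩

/-- `Exec W p s s' t`: on a machine whose words are the numbers below `W`, the program `p`, started
in state `s`, halts in state `s'` after exactly `t` steps. Every instruction and every test takes
one step. An instruction whose result is not a word has no execution (overflow is an error). -/
inductive Exec (W : ℕ) : Program → State → State → ℕ → Prop
  | skip (s : State) : Exec W .skip s s 1
  | const (s : State) (r k : ℕ) (h : k < W) : Exec W (.const r k) s (s.setReg r k) 1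
  | copy (s : State) (r x : ℕ) (h : s.reg x < W) :
      Exec W (.copy r x) s (s.setReg r (s.reg x)) 1
  | op (s : State) (o : Op) (r x y : ℕ) (h : o.eval (s.reg x) (s.reg y) < W) :
      Exec W (.op o r x y) s (s.setReg r (o.eval (s.reg x) (s.reg y))) 1
  | load (s : State) (r x : ℕ) (h : s.mem (s.reg x) < W) :
      Exec W (.load r x) s (s.setReg r (s.mem (s.reg x))) 1
  | store (s : State) (x y : ℕ) (h : s.reg y < W) :
      Exec W (.store x y) s (s.setMem (s.reg x) (s.reg y)) 1
  | seq {p q : Program} {s s' s'' : State} {t t' : ℕ}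
      (hp : Exec W p s s' t) (hq : Exec W q s' s'' t') : Exec W (.seq p q) s s'' (t + t')
  | ifTrue {x y : ℕ} {p q : Program} {s s' : State} {t : ℕ}
      (h : s.reg x < s.reg y) (hp : Exec W p s s' t) : Exec W (.ifLt x y p q) s s' (t + 1)
  | ifFalse {x y : ℕ} {p q : Program} {s s' : State} {t : ℕ}
      (h : ¬ s.reg x < s.reg y) (hq : Exec W q s s' t) : Exec W (.ifLt x y p q) s s' (t + 1)
  | whileFalse {x y : ℕ} {p : Program} {s : State}
      (h : ¬ s.reg x < s.reg y) : Exec W (.whileLt x y p) s s 1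
  | whileTrue {x y : ℕ} {p : Program} {s s' s'' : State} {t t' : ℕ}
      (h : s.reg x < s.reg y) (hp : Exec W p s s' t) (hw : Exec W (.whileLt x y p) s' s'' t') :
      Exec W (.whileLt x y p) s s'' (t + t' + 1)

/-- The memory `m` holds the list `l`: its length in cell `0`, its entries in cells `1, 2, …`. -/
def Holds (m : ℕ → ℕ) (l : List ℕ) : Prop :=
  m 0 = l.length ∧ ∀ (i : ℕ) (h : i < l.length), m (i + 1) = l[i]

/-- The initial state on input `l`: the memory holds `l`, everything else is `0`. -/
def initState (l : List ℕ) : State where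
  reg := fun _ => 0
  mem := fun a => if a = 0 then l.length else l.getD (a - 1) 0

/-! ### Problems and running times -/

/-- A computational problem: instances, the parameter `n` of an instance in which running times are
measured, the word list given to an algorithm, and the word list that it has to return. -/
structure Problem where
  Instance : Type
  size : Instance → ℕ
  input : Instance → List ℕ
  output : Instance → List ℕ

/-- `A` solves `Q` in time `O(n ^ e)` on a RAM with `O(log n)`-bit words. (With `n + 1` in place of
`n`, the bound also makes sense for `n = 0`.) -/
def SolvesInTime (A : Program) (Q : Problem) (e : ℝ) : Prop :=
  ∃ c : ℕ, ∀ I : Q.Instance, ∃ (s : State) (t : ℕ),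
    Exec (2 ^ (c * (Nat.log 2 (Q.size I) + 1))) A (initState (Q.input I)) s t ∧
    (t : ℝ) ≤ c * ((Q.size I : ℝ) + 1) ^ e ∧
    Holds s.mem (Q.output I)

/-- Truly subcubic time: `O(n ^ (3 - ε))` for some `ε > 0`. -/
def SolvesInTrulySubcubicTime (A : Program) (Q : Problem) : Prop :=
  ∃ ε : ℝ, 0 < ε ∧ SolvesInTime A Q (3 - ε)

/-! ### Combinatorial algorithms -/

/-- The only word operations in the program are addition and subtraction (so that it consists of
data movement, counting and comparisons). -/
def Program.AddSubOnly : Program → Prop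
  | .op o _ _ _ => o = .add ∨ o = .sub
  | .seq p q => p.AddSubOnly ∧ q.AddSubOnly
  | .ifLt _ _ p q => p.AddSubOnly ∧ q.AddSubOnly
  | .whileLt _ _ p => p.AddSubOnly
  | _ => True

/-- `p` halts after a number of steps that is linear in the length of the list in the memory and
leaves a list of linear length, whatever else the registers and the memory contain, while the
number of bits per word grows at most by a constant factor. -/
def Program.LinearTime (p : Program) : Prop :=
  ∃ c : ℕ, ∀ (w : ℕ) (s : State), (∀ r, s.reg r < 2 ^ w) → (∀ a, s.mem a < 2 ^ w) →
    ∃ (s' : State) (t : ℕ), Exec (2 ^ (c * (w + 1))) p s s' t ∧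
      t ≤ c * (s.mem 0 + 1) ∧ s'.mem 0 ≤ c * (s.mem 0 + 1)

/-- Linear-time data movement, counting and comparing. -/
def Program.Elementary (p : Program) : Prop := p.AddSubOnly ∧ p.LinearTime

/-- The algorithms that are combinatorial as soon as those in `K` are: the least class of programs
that contains `K` and the elementary linear-time programs and is closed under sequential
composition. Every class of programs with these two closure properties is of this form. -/
inductive Combinatorial (K : Set Program) : Program → Prop
  | base {p : Program} (h : p ∈ K) : Combinatorial K p
  | elementary {p : Program} (h : p.Elementary) : Combinatorial K p
  | seq {p q : Program} (hp : Combinatorial K p) (hq : Combinatorial K q) :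
      Combinatorial K (.seq p q)

/-! ### Tables -/

open Classical in
/-- The `0`/`1` table of a relation, row by row. -/
noncomputable def table {n : ℕ} (R : Fin n → Fin n → Prop) : List ℕ :=
  (List.ofFn fun i => List.ofFn fun j => if R i j then 1 else 0).flatten

/-! ### Boolean matrix multiplication -/

/-- The Boolean product, with entries `⋁ₖ (A i k ∧ B k j)`. -/
def boolMul {n : ℕ} (A B : Matrix (Fin n) (Fin n) Bool) : Matrix (Fin n) (Fin n) Bool :=
  fun i j => decide (∃ k, A i k = true ∧ B k j = true)

/-- Given `n` and two `n × n` Boolean matrices, compute their product; the parameter is `n`. -/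
noncomputable def boolMatMul : Problem where
  Instance := Σ n : ℕ, Matrix (Fin n) (Fin n) Bool × Matrix (Fin n) (Fin n) Bool
  size := fun I => I.1
  input := fun I => I.1 ::
    (table (fun i j => I.2.1 i j = true) ++ table (fun i j => I.2.2 i j = true))
  output := fun I => table (fun i j => boolMul I.2.1 I.2.2 i j = true)

/-! ### Inclusion-based points-to analysis -/

/-- Statements of a normalized program over the variables `0, …, n - 1`. -/
inductive Stmt (n : ℕ) where
  /-- `a = &b` -/
  | addressOf (a b : Fin n)
  /-- `a = b` -/
  | assign (a b : Fin n)
  /-- `a = *b` -/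
  | assignStar (a b : Fin n)
  /-- `*a = b` -/
  | starAssign (a b : Fin n)

/-- The inclusion constraint of a statement, on a family of points-to sets. -/
def Stmt.Constraint {n : ℕ} (pt : Fin n → Set (Fin n)) : Stmt n → Prop
  | .addressOf a b => b ∈ pt a
  | .assign a b => pt b ⊆ pt a
  | .assignStar a b => ∀ v ∈ pt b, pt v ⊆ pt a
  | .starAssign a b => ∀ v ∈ pt a, pt b ⊆ pt v

/-- The least solution of the inclusion constraints of a program: `q` belongs to the points-to set
of `p` if this is so in every solution. -/
def pointsToSet {n : ℕ} (P : List (Stmt n)) (p : Fin n) : Set (Fin n) :=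
  {q | ∀ pt : Fin n → Set (Fin n), (∀ S ∈ P, S.Constraint pt) → q ∈ pt p}

/-- A statement as three words. -/
def Stmt.encode {n : ℕ} : Stmt n → List ℕ
  | .addressOf a b => [0, a, b]
  | .assign a b => [1, a, b]
  | .assignStar a b => [2, a, b]
  | .starAssign a b => [3, a, b]

/-- Given a normalized program with `n` variables (the order of its statements is irrelevant, and
none is repeated), decide for all variables `p`, `q` whether `p` can point to `q`; the parameter is
the number `n` of variables. -/
noncomputable def pointsToAnalysis : Problem where
  Instance := Σ n : ℕ, {P : List (Stmt n) // P.Nodup}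
  size := fun I => I.1
  input := fun I => I.1 :: I.2.1.flatMap Stmt.encode
  output := fun I => table (fun p q => q ∈ pointsToSet I.2.1 p)

end PointsToBMM

/-! Two of the four statement forms suffice. Let variables `0, …, n - 1` stand for the rows of `A`
and for the columns of `B`, and let `n + k` stand for the inner index `k`. A one in `A i k` becomes
the assignment `i = n + k`, and a one in `B k j` becomes `n + k = &j`. In the least solution `j`
lies in the points-to set of `i` exactly when some `k` has both ones (`mem_pointsToSet_entryStmts`).

A zero entry of row `r` (rows of `A` followed by rows of `B`) yields the same statement with left
side `r + 2 n`, a dummy variable that never occurs on a right side. So there are always `2 n ^ 2`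
distinct statements over `4 n` variables, and the encoder can work in place without counting ones.
The product is the upper left block of the `4 n × 4 n` answer table.

Encoding and extraction cost `O(n ^ 2)`, and the analysis costs a constant factor more than on `n`
variables, so the exponent `3 - min δ 1` is reached. Both conversions must also halt in linear time
on arbitrary memory. Hence `reaches_encodeMatrices` and `reaches_extractBlock` give unconditional
bounds, together with correctness as an implication about the same run. -/

namespace PointsToBMM

/-! ### Reasoning about executions -/

/-- The program `p`, started in `s`, halts in a state and after a number of steps satisfying `Q`. -/
def Reaches (W : ℕ) (p : Program) (s : State) (Q : State → ℕ → Prop) : Prop :=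
  ∃ (s' : State) (t : ℕ), Exec W p s s' t ∧ Q s' t

/-- Lets the three phases, whose word bounds differ, run on one machine. -/
theorem Exec.mono {W W' : ℕ} (hW : W ≤ W') {p : Program} {s s' : State} {t : ℕ}
    (h : Exec W p s s' t) : Exec W' p s s' t := by
  induction h with
  | skip s => exact .skip s
  | const s r k h => exact .const s r k (h.trans_le hW)
  | copy s r x h => exact .copy s r x (h.trans_le hW)
  | op s o r x y h => exact .op s o r x y (h.trans_le hW)
  | load s r x h => exact .load s r x (h.trans_le hW)
  | store s x y h => exact .store s x y (h.trans_le hW)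
  | seq _ _ h1 h2 => exact .seq h1 h2
  | ifTrue h _ h1 => exact .ifTrue h h1
  | ifFalse h _ h1 => exact .ifFalse h h1
  | whileFalse h => exact .whileFalse h
  | whileTrue h _ _ h1 h2 => exact .whileTrue h h1 h2

/-- The points-to algorithm may leave anything beyond its output; this bounds such leftovers for the
extraction phase. -/
theorem Exec.mem_lt {W : ℕ} {p : Program} {s s' : State} {t : ℕ} (h : Exec W p s s' t) :
    (∀ a, s.mem a < W) → ∀ a, s'.mem a < W := by
  induction h with
  | store s x y h =>
    intro hs a
    by_cases ha : a = s.reg x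
    · simpa [State.setMem, ha] using h
    · simpa [State.setMem, Function.update_of_ne ha] using hs a
  | seq _ _ h1 h2 => exact fun hs => h2 (h1 hs)
  | ifTrue _ _ h1 => exact h1
  | ifFalse _ _ h1 => exact h1
  | whileTrue _ _ _ h1 h2 => exact fun hs => h2 (h1 hs)
  | _ => exact id

theorem Reaches.mono {W : ℕ} {p : Program} {s : State} {Q Q' : State → ℕ → Prop}
    (h : Reaches W p s Q) (hQ : ∀ s' t, Q s' t → Q' s' t) : Reaches W p s Q' := by
  obtain ⟨s', t, he, hq⟩ := h
  exact ⟨s', t, he, hQ _ _ hq⟩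

/-- This and the following equivalences form a weakest-precondition calculus: `simp` with them turns
loop-free code into arithmetic side conditions. -/
theorem reaches_skip {W : ℕ} {s : State} {Q : State → ℕ → Prop} :
    Reaches W .skip s Q ↔ Q s 1 :=
  ⟨by rintro ⟨s', t, ⟨⟩, hq⟩; exact hq, fun h => ⟨_, _, .skip s, h⟩⟩

theorem reaches_const {W r k : ℕ} {s : State} {Q : State → ℕ → Prop} :
    Reaches W (.const r k) s Q ↔ k < W ∧ Q (s.setReg r k) 1 :=
  ⟨by rintro ⟨s', t, ⟨⟩, hq⟩; exact ⟨by assumption, hq⟩, fun h => ⟨_, _, .const s r k h.1, h.2⟩⟩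

theorem reaches_copy {W r x : ℕ} {s : State} {Q : State → ℕ → Prop} :
    Reaches W (.copy r x) s Q ↔ s.reg x < W ∧ Q (s.setReg r (s.reg x)) 1 :=
  ⟨by rintro ⟨s', t, ⟨⟩, hq⟩; exact ⟨by assumption, hq⟩, fun h => ⟨_, _, .copy s r x h.1, h.2⟩⟩

theorem reaches_op {W : ℕ} {o : Op} {r x y : ℕ} {s : State} {Q : State → ℕ → Prop} :
    Reaches W (.op o r x y) s Q ↔
      o.eval (s.reg x) (s.reg y) < W ∧ Q (s.setReg r (o.eval (s.reg x) (s.reg y))) 1 :=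
  ⟨by rintro ⟨s', t, ⟨⟩, hq⟩; exact ⟨by assumption, hq⟩, fun h => ⟨_, _, .op s o r x y h.1, h.2⟩⟩

theorem reaches_load {W r x : ℕ} {s : State} {Q : State → ℕ → Prop} :
    Reaches W (.load r x) s Q ↔
      s.mem (s.reg x) < W ∧ Q (s.setReg r (s.mem (s.reg x))) 1 :=
  ⟨by rintro ⟨s', t, ⟨⟩, hq⟩; exact ⟨by assumption, hq⟩, fun h => ⟨_, _, .load s r x h.1, h.2⟩⟩

theorem reaches_store {W x y : ℕ} {s : State} {Q : State → ℕ → Prop} :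
    Reaches W (.store x y) s Q ↔ s.reg y < W ∧ Q (s.setMem (s.reg x) (s.reg y)) 1 :=
  ⟨by rintro ⟨s', t, ⟨⟩, hq⟩; exact ⟨by assumption, hq⟩, fun h => ⟨_, _, .store s x y h.1, h.2⟩⟩

theorem reaches_seq {W : ℕ} {p q : Program} {s : State} {Q : State → ℕ → Prop} :
    Reaches W (.seq p q) s Q ↔
      Reaches W p s fun s' t => Reaches W q s' fun s'' t' => Q s'' (t + t') := by
  constructor
  · rintro ⟨s', t, ⟨⟩, hq⟩
    exact ⟨_, _, by assumption, _, _, by assumption, hq⟩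
  · rintro ⟨s', t, h1, s'', t', h2, hq⟩
    exact ⟨_, _, .seq h1 h2, hq⟩

theorem reaches_ifLt {W x y : ℕ} {p q : Program} {s : State} {Q : State → ℕ → Prop} :
    Reaches W (.ifLt x y p q) s Q ↔
      (s.reg x < s.reg y → Reaches W p s fun s' t => Q s' (t + 1)) ∧
      (s.reg y ≤ s.reg x → Reaches W q s fun s' t => Q s' (t + 1)) := by
  constructor
  · rintro ⟨s', t, h, hq⟩
    cases h with
    | ifTrue h hp => exact ⟨fun _ => ⟨_, _, hp, hq⟩, fun h' => absurd h h'.not_gt⟩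
    | ifFalse h hp => exact ⟨fun h' => absurd h' h, fun _ => ⟨_, _, hp, hq⟩⟩
  · rintro ⟨h1, h2⟩
    by_cases h : s.reg x < s.reg y
    · obtain ⟨s', t, he, hq⟩ := h1 h
      exact ⟨_, _, .ifTrue h he, hq⟩
    · obtain ⟨s', t, he, hq⟩ := h2 (not_lt.1 h)
      exact ⟨_, _, .ifFalse h he, hq⟩

/-- The rule for loops, with an invariant `I` that is indexed by a variant. -/
theorem reaches_whileLt {W x y T : ℕ} {p : Program} {I : ℕ → State → Prop}
    (hp : ∀ k s, I k s → s.reg x < s.reg y →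
      0 < k ∧ Reaches W p s fun s' t => t ≤ T ∧ I (k - 1) s') :
    ∀ k s, I k s → Reaches W (.whileLt x y p) s fun s' t =>
      t ≤ (T + 1) * k + 1 ∧ s'.reg y ≤ s'.reg x ∧ ∃ k', I k' s' := by
  intro k
  induction k with
  | zero =>
    intro s hs
    by_cases h : s.reg x < s.reg y
    · exact absurd (hp 0 s hs h).1 (lt_irrefl 0)
    · exact ⟨s, 1, .whileFalse h, by omega, not_lt.1 h, _, hs⟩
  | succ k ih =>
    intro s hs
    by_cases h : s.reg x < s.reg y
    · obtain ⟨-, s1, t1, h1, ht1, hi⟩ := hp _ s hs h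
      obtain ⟨s2, t2, h2, ht2, hq⟩ := ih s1 hi
      exact ⟨s2, _, .whileTrue h h1 h2, by nlinarith, hq⟩
    · exact ⟨s, 1, .whileFalse h, by nlinarith [Nat.zero_le ((T + 1) * (k + 1))], not_lt.1 h, _, hs⟩

theorem State.reg_setReg (s : State) (r v x : ℕ) :
    (s.setReg r v).reg x = if x = r then v else s.reg x := by
  simp [State.setReg, Function.update_apply]

theorem State.mem_setReg (s : State) (r v : ℕ) : (s.setReg r v).mem = s.mem := rfl

theorem State.reg_setMem (s : State) (a v : ℕ) : (s.setMem a v).reg = s.reg := rfl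

theorem State.mem_setMem (s : State) (a v b : ℕ) :
    (s.setMem a v).mem b = if b = a then v else s.mem b := by
  simp [State.setMem, Function.update_apply]

/-! ### Encoding a pair of matrices as a normalized program -/

/-- Compute the statement (registers `7`, `8`, `9`) for the matrix entry in the cell with address in
register `1`. -/
def computeStmt : Program :=
  .seq (.load 7 1) <| .seq (.copy 8 3) <|
  .seq (.ifLt 0 7 .skip (.op .add 8 3 11)) <|
  .seq (.op .sub 9 4 6) <| .seq (.const 7 0) <|
  .ifLt 3 2 (.seq (.op .add 9 9 2) (.const 7 1)) .skip

/-- Store the statement in the registers `7`, `8`, `9` and go to the previous matrix entry. -/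
def storeStmt : Program :=
  .seq (.store 5 9) <| .seq (.op .sub 5 5 6) <|
  .seq (.store 5 8) <| .seq (.op .sub 5 5 6) <|
  .seq (.store 5 7) <| .seq (.op .sub 5 5 6) <|
  .seq (.op .sub 4 4 6) <|
  .seq (.ifLt 0 4 .skip (.seq (.copy 4 2) (.op .sub 3 3 6))) <|
  .op .sub 1 1 6

/-- Replace one matrix entry by a statement. -/
def encodeEntry : Program := .seq computeStmt storeStmt

/-- Initialization of the registers for `encodeLoop`. -/
def encodeInit : Program :=
  .seq (.const 0 0) <| .seq (.const 6 1) <| .seq (.load 1 0) <| .seq (.load 2 6) <|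
  .seq (.op .add 11 2 2) <| .seq (.op .sub 3 11 6) <| .seq (.copy 4 2) <|
  .seq (.op .add 5 1 1) <| .seq (.op .add 5 5 1) <| .seq (.op .sub 5 5 6) <|
  .seq (.op .sub 5 5 6) (.copy 10 5)

/-- Replace all matrix entries by statements, from the last one to the first one. -/
def encodeLoop : Program := .whileLt 6 1 encodeEntry

/-- Write the length of the list and the number of variables, and clear all registers. -/
def encodeFinish : Program :=
  .seq (.op .add 11 11 11) <| .seq (.store 6 11) <| .seq (.store 0 10) <|
  .seq (.const 1 0) <| .seq (.const 2 0) <| .seq (.const 3 0) <| .seq (.const 4 0) <|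
  .seq (.const 5 0) <| .seq (.const 6 0) <| .seq (.const 7 0) <| .seq (.const 8 0) <|
  .seq (.const 9 0) <| .seq (.const 10 0) (.const 11 0)

/-- Turn a list that holds `n` and two `n × n` matrices into one that holds `4 n` and a normalized
program, in place. -/
def encodeMatrices : Program := .seq encodeInit (.seq encodeLoop encodeFinish)

theorem reaches_computeStmt {W X : ℕ} {s : State} (h0 : s.reg 0 = 0) (h6 : s.reg 6 = 1)
    (hW : 2 * X + 1 < W) (h2 : s.reg 2 ≤ X) (h3 : s.reg 3 ≤ X) (h4 : s.reg 4 ≤ X)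
    (h11 : s.reg 11 ≤ X) (hm : s.mem (s.reg 1) < W) :
    Reaches W computeStmt s fun s' t => t ≤ 9 ∧ s'.mem = s.mem ∧
      s'.reg 7 = (if s.reg 3 < s.reg 2 then 1 else 0) ∧
      s'.reg 8 = (if 0 < s.mem (s.reg 1) then s.reg 3 else s.reg 3 + s.reg 11) ∧
      s'.reg 9 = s.reg 4 - 1 + (if s.reg 3 < s.reg 2 then s.reg 2 else 0) ∧
      ∀ r, r ≠ 7 → r ≠ 8 → r ≠ 9 → s'.reg r = s.reg r := by
  simp only [computeStmt, reaches_seq, reaches_load, reaches_copy, reaches_ifLt, reaches_skip,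
    reaches_op, reaches_const, State.reg_setReg, State.mem_setReg, Op.eval, h0, h6, if_true,
    if_false, Nat.reduceEqDiff, OfNat.zero_ne_ofNat]
  repeat' first | intro _ | apply And.intro
  all_goals first | trivial | omega | (split_ifs <;> omega)

theorem reaches_storeStmt {W : ℕ} {s : State} (h0 : s.reg 0 = 0) (h6 : s.reg 6 = 1)
    (h1 : s.reg 1 < W) (h2 : s.reg 2 < W) (h3 : s.reg 3 < W) (h4 : s.reg 4 < W) (h5 : s.reg 5 < W)
    (h7 : s.reg 7 < W) (h8 : s.reg 8 < W) (h9 : s.reg 9 < W) :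
    Reaches W storeStmt s fun s' t => t ≤ 12 ∧ s'.reg 1 = s.reg 1 - 1 ∧
      s'.reg 3 = (if 1 < s.reg 4 then s.reg 3 else s.reg 3 - 1) ∧
      s'.reg 4 = (if 1 < s.reg 4 then s.reg 4 - 1 else s.reg 2) ∧
      s'.reg 5 = s.reg 5 - 3 ∧
      (∀ r, r ≠ 1 → r ≠ 3 → r ≠ 4 → r ≠ 5 → s'.reg r = s.reg r) ∧
      ∀ a, s'.mem a =
        if a = s.reg 5 - 2 then s.reg 7 else if a = s.reg 5 - 1 then s.reg 8
        else if a = s.reg 5 then s.reg 9 else s.mem a := by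
  simp only [storeStmt, reaches_seq, reaches_copy, reaches_ifLt, reaches_skip, reaches_op,
    reaches_store, State.reg_setReg, State.mem_setReg, State.reg_setMem, State.mem_setMem, Op.eval,
    h0, h6, if_true, if_false, Nat.reduceEqDiff, OfNat.zero_ne_ofNat, OfNat.one_ne_ofNat]
  repeat' first | intro _ | apply And.intro
  all_goals first | trivial | omega | (split_ifs <;> omega)

theorem reaches_encodeEntry {W X : ℕ} {s : State} (h0 : s.reg 0 = 0) (h6 : s.reg 6 = 1)
    (hW : 2 * X + 1 < W) (h1 : s.reg 1 ≤ X) (h2 : s.reg 2 ≤ X) (h3 : s.reg 3 ≤ X)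
    (h4 : s.reg 4 ≤ X) (h5 : s.reg 5 < W) (h11 : s.reg 11 ≤ X) (hm : s.mem (s.reg 1) < W) :
    Reaches W encodeEntry s fun s' t => t ≤ 21 ∧
      s'.reg 0 = 0 ∧ s'.reg 6 = 1 ∧ s'.reg 1 = s.reg 1 - 1 ∧ s'.reg 2 = s.reg 2 ∧
      s'.reg 3 = (if 1 < s.reg 4 then s.reg 3 else s.reg 3 - 1) ∧
      s'.reg 4 = (if 1 < s.reg 4 then s.reg 4 - 1 else s.reg 2) ∧
      s'.reg 5 = s.reg 5 - 3 ∧ s'.reg 10 = s.reg 10 ∧ s'.reg 11 = s.reg 11 ∧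
      (∀ r, 12 ≤ r → s'.reg r = s.reg r) ∧
      ∀ a, s'.mem a =
        if a = s.reg 5 - 2 then (if s.reg 3 < s.reg 2 then 1 else 0)
        else if a = s.reg 5 - 1 then
          (if 0 < s.mem (s.reg 1) then s.reg 3 else s.reg 3 + s.reg 11)
        else if a = s.reg 5 then s.reg 4 - 1 + (if s.reg 3 < s.reg 2 then s.reg 2 else 0)
        else s.mem a := by
  refine reaches_seq.2 ((reaches_computeStmt h0 h6 hW h2 h3 h4 h11 hm).mono ?_)
  rintro s1 t1 ⟨ht1, em, e7, e8, e9, er⟩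
  have g0 := er 0 (by omega) (by omega) (by omega)
  have g1 := er 1 (by omega) (by omega) (by omega)
  have g2 := er 2 (by omega) (by omega) (by omega)
  have g3 := er 3 (by omega) (by omega) (by omega)
  have g4 := er 4 (by omega) (by omega) (by omega)
  have g5 := er 5 (by omega) (by omega) (by omega)
  have g6 := er 6 (by omega) (by omega) (by omega)
  refine (reaches_storeStmt (by omega) (by omega) (by omega) (by omega) (by omega) (by omega)
    (by omega) (by rw [e7]; split_ifs <;> omega) (by rw [e8]; split_ifs <;> omega)
    (by rw [e9]; split_ifs <;> omega)).mono ?_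
  rintro s2 t2 ⟨ht2, f1, f3, f4, f5, fr, fm⟩
  have hr : ∀ r, r ≠ 1 → r ≠ 3 → r ≠ 4 → r ≠ 5 → r ≠ 7 → r ≠ 8 → r ≠ 9 →
      s2.reg r = s.reg r := fun r _ _ _ _ _ _ _ => by rw [fr, er] <;> assumption
  rw [e7, e8, e9, em, g5] at fm
  rw [g4, g3] at f3
  rw [g4, g2] at f4
  refine ⟨by omega, ?_, ?_, by omega, ?_, f3, f4, by omega, ?_, ?_, fun r hr' => ?_, fm⟩
  · rw [hr 0] <;> omega
  · rw [hr 6] <;> omega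
  all_goals apply hr <;> omega

/-! ### Extracting a block of the points-to table -/

/-- Determine the dimension `n` (register `2`) and `n ^ 2` (register `3`) from the length `16 n ^ 2`
of a table. -/
def rootLoop : Program :=
  .whileLt 5 1 <|
    .seq (.op .add 3 3 4) <| .seq (.op .add 4 4 7) <| .seq (.op .add 2 2 6) <|
    .seq (.op .add 5 3 3) <| .seq (.op .add 5 5 5) <| .seq (.op .add 5 5 5) (.op .add 5 5 5)

/-- Initialization of the registers for `rootLoop`. -/
def rootInit : Program :=
  .seq (.const 0 0) <| .seq (.const 6 1) <| .seq (.const 7 2) <| .seq (.load 1 0) <|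
  .seq (.const 2 0) <| .seq (.const 3 0) <| .seq (.const 4 1) (.const 5 0)

/-- Initialization of the registers for `moveLoop`. -/
def moveInit : Program :=
  .seq (.const 8 0) <| .seq (.const 9 1) <| .seq (.const 10 0) <|
  .seq (.op .add 11 2 2) (.op .add 11 11 2)

/-- Move the entries of the first `n` rows and columns of a `4 n × 4 n` table to the front. -/
def moveLoop : Program :=
  .whileLt 8 3 <|
    .seq (.op .add 8 8 6) <| .seq (.load 12 9) <| .seq (.store 8 12) <|
    .seq (.op .add 9 9 6) <| .seq (.op .add 10 10 6) <|
    .ifLt 10 2 .skip (.seq (.const 10 0) (.op .add 9 9 11))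

/-- Replace a `4 n × 4 n` table by its upper left `n × n` block. -/
def extractBlock : Program :=
  .seq rootInit <| .seq rootLoop <| .seq moveInit <| .seq moveLoop (.store 0 3)

/-- Multiplication is not elementary, so squares arise as sums of consecutive odd numbers (register
`4`), and `16 m ^ 2` by four doublings. The loop stops at the least `m` with `L ≤ 16 m ^ 2`. While
it runs, `m ≤ 16 m ^ 2 < L`, which makes `L - m` a variant. -/
theorem reaches_rootLoop {W L : ℕ} {s : State} (hW : 64 * (L + 1) ≤ W) (h0 : s.reg 0 = 0)
    (h1 : s.reg 1 = L) (h2 : s.reg 2 = 0) (h3 : s.reg 3 = 0) (h4 : s.reg 4 = 1)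
    (h5 : s.reg 5 = 0) (h6 : s.reg 6 = 1) (h7 : s.reg 7 = 2) :
    Reaches W rootLoop s fun s' t => t ≤ 8 * L + 1 ∧ s'.mem = s.mem ∧ s'.reg 0 = 0 ∧
      s'.reg 6 = 1 ∧ s'.reg 3 = s'.reg 2 ^ 2 ∧ L ≤ 16 * s'.reg 2 ^ 2 ∧
      (s'.reg 2 = 0 ∨ 16 * (s'.reg 2 - 1) ^ 2 < L) := by
  refine (reaches_whileLt (T := 7) (I := fun k s' => s'.mem = s.mem ∧ s'.reg 0 = 0 ∧
      s'.reg 1 = L ∧ s'.reg 6 = 1 ∧ s'.reg 7 = 2 ∧ s'.reg 3 = s'.reg 2 ^ 2 ∧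
      s'.reg 4 = 2 * s'.reg 2 + 1 ∧ s'.reg 5 = 16 * s'.reg 2 ^ 2 ∧
      (s'.reg 2 = 0 ∨ 16 * (s'.reg 2 - 1) ^ 2 < L) ∧ k = L - s'.reg 2)
    ?_ L s ?_).mono ?_
  · rintro k s' ⟨e, e0, e1, e6, e7, e3, e4, e5, e2, rfl⟩ hlt
    rw [e1, e5] at hlt
    have hle : s'.reg 2 ≤ s'.reg 2 ^ 2 := Nat.le_self_pow two_ne_zero _
    have hsq : (s'.reg 2 + 1) ^ 2 = s'.reg 2 ^ 2 + (2 * s'.reg 2 + 1) := by ring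
    simp only [reaches_seq, reaches_op, State.reg_setReg, State.mem_setReg, Op.eval, e0, e1, e3,
      e4, e6, e7, if_true, if_false, Nat.reduceEqDiff, OfNat.zero_ne_ofNat, OfNat.one_ne_ofNat,
      hsq, Nat.add_sub_cancel]
    repeat' first | intro _ | apply And.intro
    all_goals first | trivial | omega
  · simp [*]
  · rintro s' t ⟨ht, hlt, k', e, e0, e1, e6, -, e3, -, e5, e2, -⟩
    exact ⟨ht, e, e0, e6, e3, by omega, e2⟩

/-- Copying in place is safe because the source address `r * (4 * n) + j + 1` exceeds the number `r
* n + j` of cells already written. After each row the source skips the other `3 * n` columns. -/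
theorem reaches_moveLoop {W n V : ℕ} {s : State} (hW : 8 * (n ^ 2 + 1) + V ≤ W) (h0 : s.reg 0 = 0)
    (h2 : s.reg 2 = n) (h3 : s.reg 3 = n ^ 2) (h6 : s.reg 6 = 1) (h8 : s.reg 8 = 0)
    (h9 : s.reg 9 = 1) (h10 : s.reg 10 = 0) (h11 : s.reg 11 = 3 * n) (hm : ∀ a, s.mem a < V) :
    Reaches W moveLoop s fun s' t => t ≤ 10 * n ^ 2 + 1 ∧ s'.reg 0 = 0 ∧ s'.reg 3 = n ^ 2 ∧
      ∀ i < n, ∀ j < n, s'.mem (i * n + j + 1) = s.mem (i * (4 * n) + j + 1) := by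
  refine (reaches_whileLt (T := 9) (I := fun k s' => s'.reg 0 = 0 ∧ s'.reg 2 = n ∧
      s'.reg 3 = n ^ 2 ∧ s'.reg 6 = 1 ∧ s'.reg 11 = 3 * n ∧ k + s'.reg 8 = n ^ 2 ∧
      (∃ r, s'.reg 8 = r * n + s'.reg 10 ∧ s'.reg 9 = r * (4 * n) + s'.reg 10 + 1 ∧
        (0 < n → s'.reg 10 < n)) ∧
      (∀ i < n, ∀ j < n, i * n + j < s'.reg 8 →
        s'.mem (i * n + j + 1) = s.mem (i * (4 * n) + j + 1)) ∧
      ∀ a, s'.reg 8 < a → s'.mem a = s.mem a) ?_ (n ^ 2) s ?_).mono ?_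
  · rintro k s' ⟨e0, e2, e3, e6, e11, hk, ⟨r, e8, e9, e10⟩, hold, hnew⟩ hlt
    rw [e3] at hlt
    have hn : 0 < n := by
      rcases Nat.eq_zero_or_pos n with rfl | h
      · simp at hlt
      · exact h
    have hj := e10 hn
    have hr : r * (4 * n) = 4 * (r * n) := by ring
    have hload : s'.mem (s'.reg 9) = s.mem (s'.reg 9) := hnew _ (by omega)
    have hmV := hm (s'.reg 9)
    have hmem : ∀ i < n, ∀ j < n, i * n + j < s'.reg 8 + 1 →
        (if i * n + j = s'.reg 8 then s.mem (s'.reg 9) else s'.mem (i * n + j + 1)) =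
          s.mem (i * (4 * n) + j + 1) := by
      intro i hi j hj' hij
      split_ifs with h
      -- The cell just written: division by `n` recovers its row, hence its source.
      · have h' : i * n + j = r * n + s'.reg 10 := by omega
        have hir : i = r := by
          have := congrArg (· / n) h'
          simpa [Nat.add_comm _ j, Nat.add_comm _ (s'.reg 10), Nat.add_mul_div_right, hn,
            Nat.div_eq_of_lt, hj, hj'] using this
        subst hir
        rw [e9]
        congr 2
        omega
      · exact hold i hi j hj' (by omega)
    simp only [reaches_seq, reaches_op, reaches_load, reaches_store, reaches_ifLt, reaches_skip,
      reaches_const, State.reg_setReg, State.mem_setReg, State.reg_setMem, State.mem_setMem,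
      Op.eval, e0, e2, e3, e6, e11, hload, if_true, if_false, Nat.reduceEqDiff,
      OfNat.zero_ne_ofNat]
    refine ⟨by omega, by omega, by omega, by omega, by omega, by omega, fun h => ?_, fun h => ?_⟩
    · refine ⟨by omega, trivial, trivial, trivial, trivial, trivial, by omega,
        ⟨r, by omega, by omega, by omega⟩, hmem, fun a ha => ?_⟩
      rw [if_neg (by omega)]
      exact hnew a (by omega)
    · refine ⟨by omega, by omega, by omega, trivial, trivial, trivial, trivial, trivial, by omega,
        ⟨r + 1, ?_, ?_, by omega⟩, hmem, fun a ha => ?_⟩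
      · rw [Nat.add_mul]
        omega
      · rw [Nat.add_mul]
        omega
      rw [if_neg (by omega)]
      exact hnew a (by omega)
  · refine ⟨h0, h2, h3, h6, h11, by omega, ⟨0, by omega, by omega, by omega⟩, ?_, fun _ _ => rfl⟩
    intro i _ j _ h
    omega
  · rintro s' t ⟨ht, hlt, k', e0, e2, e3, e6, e11, hk, -, hold, -⟩
    refine ⟨ht, e0, e3, fun i hi j hj => hold i hi j hj ?_⟩
    have : (i + 1) * n ≤ n * n := Nat.mul_le_mul_right n hi
    rw [Nat.add_mul] at this
    rw [e3, pow_two] at hlt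
    omega

theorem reaches_extractBlock {W V : ℕ} {s : State} (hm : ∀ a, s.mem a < V)
    (hW : 64 * (V + 1) ≤ W) :
    Reaches W extractBlock s fun s' t => t ≤ 64 * (s.mem 0 + 1) ∧
      s'.mem 0 ≤ s.mem 0 + 2 ∧
      ∀ n, s.mem 0 = 16 * n ^ 2 → s'.mem 0 = n ^ 2 ∧
        ∀ i < n, ∀ j < n, s'.mem (i * n + j + 1) = s.mem (i * (4 * n) + j + 1) := by
  have hL := hm 0
  simp only [extractBlock, rootInit, reaches_seq, reaches_const, reaches_load, State.reg_setReg,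
    State.mem_setReg, if_true, if_false, OfNat.zero_ne_ofNat]
  refine ⟨by omega, by omega, by omega, by omega, by omega, by omega, by omega, by omega, ?_⟩
  refine (reaches_rootLoop (L := s.mem 0) ?_ ?_ ?_ ?_ ?_ ?_ ?_ ?_ ?_).mono ?_
  · omega
  any_goals simp [State.reg_setReg]
  intro s1 t1 ht1 hmem1 e0 e6 e3 hle hgt
  simp only [State.mem_setReg] at hmem1
  -- By minimality `16 k ^ 2 < L` for `k = m - 1`, and `(k + 1) ^ 2 ≤ 2 k ^ 2 + 2`.
  have hsq : s1.reg 2 ^ 2 ≤ s.mem 0 + 2 := by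
    rcases hgt with h | h
    · simp [h]
    · obtain ⟨k, hk⟩ : ∃ k, s1.reg 2 ≤ k + 1 ∧ s1.reg 2 - 1 = k := ⟨_, by omega, rfl⟩
      rw [hk.2] at h
      nlinarith [Nat.pow_le_pow_left hk.1 2, sq_nonneg ((k : ℤ) - 1)]
  have hle2 : s1.reg 2 ≤ s1.reg 2 ^ 2 := Nat.le_self_pow two_ne_zero _
  simp only [moveInit, reaches_seq, reaches_const, reaches_op, Op.eval, State.reg_setReg, if_true,
    if_false, Nat.reduceEqDiff]
  refine ⟨by omega, by omega, by omega, by omega, by omega, ?_⟩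
  refine (reaches_moveLoop (n := s1.reg 2) (V := V) ?_ ?_ ?_ ?_ ?_ ?_ ?_ ?_ ?_ ?_).mono ?_
  · omega
  any_goals simp [State.reg_setReg, e0, e6, e3]
  · omega
  · simpa [State.mem_setReg, hmem1] using hm
  intro s2 t2 ht2 f0 f3 hmv
  simp only [reaches_store, State.mem_setMem, f0, f3]
  refine ⟨by omega, by omega, by simpa using hsq, fun n hn => ?_⟩
  have hn2 : s1.reg 2 = n := by
    rw [hn] at hle hgt
    refine le_antisymm ?_ ?_
    · rcases hgt with h | h
      · omega
      · have := lt_of_pow_lt_pow_left₀ 2 (Nat.zero_le _) (lt_of_mul_lt_mul_left h (Nat.zero_le 16))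
        omega
    · exact (Nat.pow_le_pow_iff_left two_ne_zero).1 (by omega)
  subst hn2
  refine ⟨by simp, fun i hi j hj => ?_⟩
  rw [if_neg (by omega), hmv i hi j hj]
  simp [State.mem_setReg, hmem1]

/-! ### Correctness of the in-place encoder -/

/-- In the state `s`, the memory holds `n` and two `n × n` matrices, and `T` is the memory content
that `encodeMatrices` has to produce. -/
structure EncodeSpec (s : State) (n : ℕ) (T : ℕ → ℕ) : Prop where
  length : s.mem 0 = 2 * n ^ 2 + 1
  dim : s.mem 1 = n
  reg : ∀ r, 12 ≤ r → s.reg r = 0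
  target_length : T 0 = 6 * n ^ 2 + 1
  target_dim : T 1 = 4 * n
  target_rest : ∀ a, 6 * n ^ 2 + 2 ≤ a → s.mem a = T a
  target_kind : ∀ r < 2 * n, ∀ j < n, T (3 * (r * n + j) + 2) = if r < n then 1 else 0
  target_left : ∀ r < 2 * n, ∀ j < n, T (3 * (r * n + j) + 3) =
    if 0 < s.mem (r * n + j + 2) then r else r + 2 * n
  target_right : ∀ r < 2 * n, ∀ j < n, T (3 * (r * n + j) + 4) = j + if r < n then n else 0

/-- The invariant of `encodeLoop` as far as the correctness of `encodeMatrices` is concerned: `k`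
matrix entries are left. -/
structure EncodeInvariant (s : State) (n : ℕ) (T : ℕ → ℕ) (k : ℕ) (s' : State) : Prop where
  reg_two : s'.reg 2 = n
  reg_eleven : s'.reg 11 = 2 * n
  reg_five : s'.reg 5 = 3 * k + 1
  reg_ge : ∀ r, 12 ≤ r → s'.reg r = 0
  index : 0 < k → s'.reg 3 * n + s'.reg 4 = k ∧ 1 ≤ s'.reg 4 ∧ s'.reg 4 ≤ n
  bound : k ≤ 2 * n ^ 2
  mem : ∀ a, s'.mem a = if a < 3 * k + 2 then s.mem a else T a

/-- Entry `k`, counted from one, sits in cell `k + 1` and is replaced by cells `3 k - 1`, `3 k`, `3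
k + 1`. Going backwards, these never precede the cell being read, so unread entries survive.
Register `4` is the column counted from one, register `3` the row counted from zero. -/
theorem EncodeInvariant.step {s s1 s2 : State} {n k : ℕ} {T : ℕ → ℕ} (hs : EncodeSpec s n T)
    (h : EncodeInvariant s n T k s1) (hk : 0 < k) (h1 : s1.reg 1 = k + 1)
    (e2 : s2.reg 2 = s1.reg 2)
    (e3 : s2.reg 3 = if 1 < s1.reg 4 then s1.reg 3 else s1.reg 3 - 1)
    (e4 : s2.reg 4 = if 1 < s1.reg 4 then s1.reg 4 - 1 else s1.reg 2)
    (e5 : s2.reg 5 = s1.reg 5 - 3) (e11 : s2.reg 11 = s1.reg 11)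
    (er : ∀ r, 12 ≤ r → s2.reg r = s1.reg r)
    (em : ∀ a, s2.mem a =
        if a = s1.reg 5 - 2 then (if s1.reg 3 < s1.reg 2 then 1 else 0)
        else if a = s1.reg 5 - 1 then
          (if 0 < s1.mem (s1.reg 1) then s1.reg 3 else s1.reg 3 + s1.reg 11)
        else if a = s1.reg 5 then s1.reg 4 - 1 + (if s1.reg 3 < s1.reg 2 then s1.reg 2 else 0)
        else s1.mem a) :
    EncodeInvariant s n T (k - 1) s2 := by
  obtain ⟨hi, hj1, hjn⟩ := h.index hk
  have hr : s1.reg 3 < 2 * n := by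
    have := h.bound
    by_contra! hcon
    have := Nat.mul_le_mul_right n hcon
    rw [pow_two] at *
    nlinarith
  have hj : s1.reg 4 - 1 < n := by omega
  have hidx : s1.reg 3 * n + (s1.reg 4 - 1) = k - 1 := by omega
  have hT1 := hs.target_kind _ hr _ hj
  have hT2 := hs.target_left _ hr _ hj
  have hT3 := hs.target_right _ hr _ hj
  rw [hidx] at hT1 hT2 hT3
  refine ⟨by rw [e2, h.reg_two], by rw [e11, h.reg_eleven], ?_, fun r hr => ?_, ?_, ?_, ?_⟩
  · rw [e5, h.reg_five]
    omega
  · rw [er r hr, h.reg_ge r hr]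
  · intro hk'
    rw [e3, e4, h.reg_two]
    split_ifs with h4
    · omega
    · obtain ⟨r, hr'⟩ : ∃ r, s1.reg 3 = r + 1 := by
        refine Nat.exists_eq_succ_of_ne_zero fun h0 => ?_
        rw [h0] at hi
        omega
      rw [hr', Nat.add_mul] at hi
      rw [hr']
      simp only [Nat.add_sub_cancel]
      omega
  · exact (Nat.sub_le _ _).trans h.bound
  · intro a
    have hload : s1.mem (s1.reg 1) = s.mem (k - 1 + 2) := by
      rw [h.mem, if_pos (by omega), h1]
      congr 1
      omega
    rw [em, hload, h.reg_five, h.reg_two, h.reg_eleven, h.mem]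
    by_cases ha1 : a = 3 * (k - 1) + 2
    · rw [if_pos (by omega), if_neg (show ¬a < 3 * (k - 1) + 2 by omega), ha1, hT1]
    rw [if_neg (by omega)]
    by_cases ha2 : a = 3 * (k - 1) + 3
    · rw [if_pos (by omega), if_neg (show ¬a < 3 * (k - 1) + 2 by omega), ha2, hT2]
    rw [if_neg (by omega)]
    by_cases ha3 : a = 3 * (k - 1) + 4
    · rw [if_pos (by omega), if_neg (show ¬a < 3 * (k - 1) + 2 by omega), ha3, hT3]
    rw [if_neg (by omega)]
    by_cases ha : a < 3 * k + 2
    · rw [if_pos ha, if_pos (by omega)]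
    · rw [if_neg ha, if_neg (by omega)]

/-- The size bounds survive any memory content, as truncated subtraction never increases a register.
The correctness invariant is carried along as an implication. -/
theorem reaches_encodeLoop {W V : ℕ} {s s0 : State} (hW : 8 * V + 8 ≤ W) (h0 : s.reg 0 = 0)
    (h6 : s.reg 6 = 1) (h1 : s.reg 1 ≤ V) (h2 : s.reg 2 ≤ V) (h3 : s.reg 3 ≤ 2 * V)
    (h4 : s.reg 4 ≤ V) (h5 : s.reg 5 < W) (h11 : s.reg 11 ≤ 2 * V) (hm : ∀ a, s.mem a < W)
    (hinv : ∀ n T, EncodeSpec s0 n T → EncodeInvariant s0 n T (s.reg 1 - 1) s) :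
    Reaches W encodeLoop s fun s' t => t ≤ 22 * s.reg 1 + 1 ∧ s'.reg 0 = 0 ∧ s'.reg 6 = 1 ∧
      s'.reg 10 = s.reg 10 ∧ s'.reg 11 ≤ 2 * V ∧
      ∀ n T, EncodeSpec s0 n T → EncodeInvariant s0 n T 0 s' := by
  refine (reaches_whileLt (T := 21) (I := fun k s' => s'.reg 0 = 0 ∧ s'.reg 6 = 1 ∧
      s'.reg 1 ≤ V ∧ s'.reg 2 ≤ V ∧ s'.reg 3 ≤ 2 * V ∧ s'.reg 4 ≤ V ∧ s'.reg 5 < W ∧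
      s'.reg 11 ≤ 2 * V ∧ (∀ a, s'.mem a < W) ∧ s'.reg 10 = s.reg 10 ∧ k = s'.reg 1 - 1 ∧
      ∀ n T, EncodeSpec s0 n T → EncodeInvariant s0 n T k s')
    ?_ (s.reg 1 - 1) s ?_).mono ?_
  · rintro k s1 ⟨g0, g6, g1, g2, g3, g4, g5, g11, gm, g10, rfl, ginv⟩ hlt
    rw [g6] at hlt
    refine ⟨by omega, (reaches_encodeEntry (X := 2 * V) g0 g6 (by omega) (by omega) (by omega) g3
      (by omega) g5 g11 (gm _)).mono ?_⟩
    rintro s2 t ⟨ht, e0, e6, e1, e2, e3, e4, e5, e10, e11, er, em⟩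
    refine ⟨ht, e0, e6, by omega, by omega, ?_, ?_, by omega, by omega, ?_, by omega, by omega,
      fun n T hT => (ginv n T hT).step hT (by omega) (by omega) e2 e3 e4 e5 e11 er em⟩
    · rw [e3]
      split_ifs <;> omega
    · rw [e4]
      split_ifs <;> omega
    · intro a
      have := gm a
      rw [em]
      split_ifs <;> omega
  · exact ⟨h0, h6, h1, h2, h3, h4, h5, h11, hm, rfl, rfl, hinv⟩
  · rintro s' t ⟨ht, hlt, k, g0, g6, g1, g2, g3, g4, g5, g11, gm, g10, rfl, ginv⟩
    have hk : s'.reg 1 - 1 = 0 := by omega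
    rw [hk] at ginv
    exact ⟨by omega, g0, g6, g10, g11, ginv⟩

theorem reaches_encodeFinish {W : ℕ} {s : State} (h0 : s.reg 0 = 0) (h6 : s.reg 6 = 1)
    (h10 : s.reg 10 < W) (h11 : 2 * s.reg 11 < W) :
    Reaches W encodeFinish s fun s' t => t ≤ 14 ∧
      (∀ a, s'.mem a =
        if a = 0 then s.reg 10 else if a = 1 then s.reg 11 + s.reg 11 else s.mem a) ∧
      ∀ r, s'.reg r = if 1 ≤ r ∧ r < 12 then 0 else s.reg r := by
  simp only [encodeFinish, reaches_seq, reaches_const, reaches_op, reaches_store, Op.eval,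
    State.reg_setReg, State.mem_setReg, State.reg_setMem, State.mem_setMem, if_true, if_false,
    Nat.reduceEqDiff, OfNat.zero_ne_ofNat, h0, h6]
  repeat' apply And.intro
  any_goals first | trivial | omega | (intro _; trivial)
  intro r
  by_cases hr : 1 ≤ r ∧ r < 12
  · rw [if_pos hr]
    obtain ⟨h1, h2⟩ := hr
    interval_cases r <;> rfl
  · rw [if_neg hr]
    simp only [show r ≠ 1 by omega, show r ≠ 2 by omega, show r ≠ 3 by omega, show r ≠ 4 by omega,
      show r ≠ 5 by omega, show r ≠ 6 by omega, show r ≠ 7 by omega, show r ≠ 8 by omega,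
      show r ≠ 9 by omega, show r ≠ 10 by omega, show r ≠ 11 by omega, if_false]

theorem State.eq_mk {s : State} {f g : ℕ → ℕ} (hf : ∀ r, s.reg r = f r) (hg : ∀ a, s.mem a = g a) :
    s = ⟨f, g⟩ := by
  cases s
  simp only [State.mk.injEq]
  exact ⟨funext hf, funext hg⟩

theorem reaches_encodeMatrices {W V : ℕ} {s : State} (hm : ∀ a, s.mem a < V)
    (hW : 64 * (V + 1) ≤ W) :
    Reaches W encodeMatrices s fun s' t => t ≤ 64 * (s.mem 0 + 1) ∧ s'.mem 0 ≤ 3 * s.mem 0 ∧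
      ∀ n T, EncodeSpec s n T → s' = ⟨fun _ => 0, T⟩ := by
  have hm0 := hm 0
  have hm1 := hm 1
  simp only [encodeMatrices, encodeInit, reaches_seq, reaches_const, reaches_load, reaches_op,
    reaches_copy, State.reg_setReg, State.mem_setReg, Op.eval, if_true, if_false,
    Nat.reduceEqDiff, OfNat.zero_ne_ofNat, OfNat.one_ne_ofNat]
  refine ⟨by omega, by omega, by omega, by omega, by omega, by omega, by omega, by omega,
    by omega, by omega, by omega, by omega, ?_⟩
  refine (reaches_encodeLoop (V := V) (s0 := s) ?_ ?_ ?_ ?_ ?_ ?_ ?_ ?_ ?_ ?_ ?_).mono ?_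
  · omega
  any_goals simp only [State.reg_setReg, if_true, if_false, Nat.reduceEqDiff, OfNat.zero_ne_ofNat,
    OfNat.one_ne_ofNat]
  any_goals omega
  · intro a
    have := hm a
    simp only [State.mem_setReg]
    omega
  · intro n T hT
    have hl := hT.length
    have hd := hT.dim
    refine ⟨?_, ?_, ?_, fun r hr => ?_, fun hk => ?_, ?_, fun a => ?_⟩
    all_goals simp only [State.reg_setReg, State.mem_setReg, if_true, if_false, Nat.reduceEqDiff,
      hl, hd]
    · omega
    · omega
    · have := hT.reg r hr
      split_ifs <;> omega
    -- The starting row `2 n - 1` would be truncated for `n = 0`, but then no entry is left.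
    · have hn : n ≠ 0 := by
        rintro rfl
        simp [hl] at hk
      obtain ⟨k, rfl⟩ := Nat.exists_eq_succ_of_ne_zero hn
      refine ⟨?_, by omega, le_rfl⟩
      have : k.succ + k.succ - 1 = 2 * k + 1 := by omega
      rw [this, Nat.succ_eq_add_one, Nat.add_sub_cancel]
      ring
    · omega
    · split_ifs with h
      · rfl
      · exact hT.target_rest a (by omega)
  rintro s1 t1 ⟨ht1, e0, e6, e10, e11, hinv⟩
  refine (reaches_encodeFinish e0 e6 (by omega) (by omega)).mono ?_
  rintro s2 t2 ⟨ht2, fm, fr⟩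
  refine ⟨by omega, ?_, fun n T hT => State.eq_mk (fun r => ?_) (fun a => ?_)⟩
  · rw [fm, if_pos rfl]
    omega
  · rw [fr]
    split_ifs
    · rfl
    · by_cases hr : r = 0
      · rw [hr, e0]
      · exact (hinv n T hT).reg_ge r (by omega)
  · have hl := hT.length
    have h0 := hT.target_length
    have h1 := hT.target_dim
    rw [fm, (hinv n T hT).mem, (hinv n T hT).reg_eleven]
    split_ifs with ha0 ha1
    · rw [ha0]
      omega
    · rw [ha1]
      omega
    · omega
    · rfl

/-! ### The two conversions are elementary -/

theorem two_pow_bound (w : ℕ) : 64 * (2 ^ w + 1) ≤ 2 ^ (64 * (w + 1)) :=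
  calc 64 * (2 ^ w + 1) ≤ 2 ^ (w + 7) := by
        have := Nat.one_le_two_pow (n := w)
        rw [pow_add]
        omega
    _ ≤ 2 ^ (64 * (w + 1)) := Nat.pow_le_pow_right (by norm_num) (by omega)

theorem encodeMatrices_elementary : encodeMatrices.Elementary := by
  refine ⟨by simp [encodeMatrices, encodeInit, encodeLoop, encodeEntry, computeStmt, storeStmt,
    encodeFinish, Program.AddSubOnly], 64, fun w s _ hm => ?_⟩
  obtain ⟨s', t, he, ht, hl, -⟩ := reaches_encodeMatrices hm (two_pow_bound w)
  exact ⟨s', t, he, ht, by omega⟩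

theorem extractBlock_elementary : extractBlock.Elementary := by
  refine ⟨by simp [extractBlock, rootInit, rootLoop, moveInit, moveLoop, Program.AddSubOnly], 64,
    fun w s _ hm => ?_⟩
  obtain ⟨s', t, he, ht, hl, -⟩ := reaches_extractBlock hm (two_pow_bound w)
  exact ⟨s', t, he, ht, by omega⟩

/-! ### The reduction -/

open Classical in
theorem table_eq_ofFn {n : ℕ} (R : Fin n → Fin n → Prop) :
    table R = List.ofFn fun e : Fin (n * n) => if R e.divNat e.modNat then 1 else 0 := by
  rw [table, List.ofFn_mul]
  congr 2
  funext i
  congr 1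
  funext j
  have h1 : ((i : ℕ) * n + j) / n = i := by
    rw [Nat.add_comm, Nat.add_mul_div_right _ _ j.pos, Nat.div_eq_of_lt j.2, Nat.zero_add]
  have h2 : ((i : ℕ) * n + j) % n = j := by
    rw [Nat.add_comm, Nat.add_mul_mod_self_right, Nat.mod_eq_of_lt j.2]
  simp only [Fin.divNat, Fin.modNat, h1, h2, Fin.eta]

theorem table_length {n : ℕ} (R : Fin n → Fin n → Prop) : (table R).length = n * n := by
  rw [table_eq_ofFn, List.length_ofFn]

theorem cell_lt {n m i j : ℕ} (hi : i < m) (hj : j < n) : i * n + j < m * n := by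
  have := Nat.mul_le_mul_right n hi
  rw [Nat.succ_mul] at this
  omega

open Classical in
theorem table_getD {n : ℕ} (R : Fin n → Fin n → Prop) (i j : ℕ) (hi : i < n) (hj : j < n) :
    (table R).getD (i * n + j) 0 = if R ⟨i, hi⟩ ⟨j, hj⟩ then 1 else 0 := by
  have h1 : (i * n + j) / n = i := by
    rw [Nat.add_comm, Nat.add_mul_div_right _ _ (by omega), Nat.div_eq_of_lt hj, Nat.zero_add]
  have h2 : (i * n + j) % n = j := by
    rw [Nat.add_comm, Nat.add_mul_mod_self_right, Nat.mod_eq_of_lt hj]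
  rw [table_eq_ofFn, List.getD_eq_getElem _ _ (by simpa using cell_lt hi hj), List.getElem_ofFn]
  simp only [Fin.divNat, Fin.modNat, h1, h2]

theorem length_flatMap_encode {n : ℕ} (l : List (Stmt n)) :
    (l.flatMap Stmt.encode).length = 3 * l.length := by
  induction l with
  | nil => rfl
  | cons S l ih =>
    rw [List.flatMap_cons, List.length_append, ih, List.length_cons]
    cases S <;> simp [Stmt.encode] <;> ring

theorem getD_flatMap_encode {n : ℕ} (l : List (Stmt n)) (e k : ℕ) (he : e < l.length)
    (hk : k < 3) : (l.flatMap Stmt.encode).getD (3 * e + k) 0 = l[e].encode.getD k 0 := by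
  induction l generalizing e with
  | nil => simp at he
  | cons S l ih =>
    have hS : S.encode.length = 3 := by cases S <;> rfl
    rw [List.flatMap_cons]
    cases e with
    | zero =>
      rw [List.getD_append _ _ _ _ (by omega)]
      simp
    | succ e =>
      rw [List.getD_append_right _ _ _ _ (by omega), hS, List.getElem_cons_succ,
        ← ih e (by simpa using he)]
      congr 1
      omega

/-- The statement for the entry in row `r` and column `j` of the matrix with the rows of `A` followed
by those of `B`. The variables `0, …, n - 1` stand for the rows of `A` and the columns of `B`, the
variables `n, …, 2 n - 1` for the columns of `A` and the rows of `B`. The left side of the statement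
for a zero entry is one of `2 n` additional variables. -/
def entryStmt {n : ℕ} (A B : Matrix (Fin n) (Fin n) Bool) (r : Fin (2 * n)) (j : Fin n) :
    Stmt (4 * n) :=
  if h : (r : ℕ) < n then
    .assign ⟨if A ⟨r, h⟩ j = true then r else r + 2 * n, by split_ifs <;> omega⟩ ⟨j + n, by omega⟩
  else
    .addressOf ⟨if B ⟨r - n, by omega⟩ j = true then r else r + 2 * n, by split_ifs <;> omega⟩
      ⟨j, by omega⟩

/-- The left side modulo `2 n` is `r`, and the right side determines `j` once the kind is known. -/
theorem entryStmt_injective {n : ℕ} (A B : Matrix (Fin n) (Fin n) Bool) :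
    Function.Injective fun x : Fin (2 * n) × Fin n => entryStmt A B x.1 x.2 := by
  rintro ⟨r, j⟩ ⟨r', j'⟩ h
  simp only [entryStmt] at h
  rw [Prod.mk.injEq, Fin.ext_iff, Fin.ext_iff]
  by_cases hr : (r : ℕ) < n <;> by_cases hr' : (r' : ℕ) < n <;>
    simp only [hr, hr', dite_true, dite_false, Stmt.assign.injEq, Stmt.addressOf.injEq,
      Fin.mk.injEq, reduceCtorEq] at h
  all_goals
    refine ⟨?_, by omega⟩
    replace h := h.1
    split_ifs at h <;> omega

/-- The normalized program for a pair of matrices. -/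
def entryStmts {n : ℕ} (A B : Matrix (Fin n) (Fin n) Bool) : List (Stmt (4 * n)) :=
  List.ofFn fun e : Fin (2 * n * n) =>
    entryStmt A B (finProdFinEquiv.symm e).1 (finProdFinEquiv.symm e).2

theorem entryStmts_nodup {n : ℕ} (A B : Matrix (Fin n) (Fin n) Bool) : (entryStmts A B).Nodup :=
  List.nodup_ofFn.2 ((entryStmt_injective A B).comp finProdFinEquiv.symm.injective)

theorem mem_entryStmts {n : ℕ} {A B : Matrix (Fin n) (Fin n) Bool} {S : Stmt (4 * n)} :
    S ∈ entryStmts A B ↔ ∃ r j, entryStmt A B r j = S := by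
  rw [entryStmts, List.mem_ofFn]
  constructor
  · rintro ⟨e, rfl⟩
    exact ⟨_, _, rfl⟩
  · rintro ⟨r, j, rfl⟩
    exact ⟨finProdFinEquiv (r, j), by simp⟩

theorem entryStmts_length {n : ℕ} (A B : Matrix (Fin n) (Fin n) Bool) :
    (entryStmts A B).length = 2 * n ^ 2 := by
  simp [entryStmts]
  ring

theorem entryStmts_getElem {n : ℕ} (A B : Matrix (Fin n) (Fin n) Bool) (r : Fin (2 * n))
    (j : Fin n) (h : (r : ℕ) * n + j < (entryStmts A B).length) :
    (entryStmts A B)[(r : ℕ) * n + j] = entryStmt A B r j := by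
  have h' : (r : ℕ) * n + j < 2 * n * n := by
    simpa [entryStmts] using h
  have : (⟨r * n + j, h'⟩ : Fin (2 * n * n)) = finProdFinEquiv (r, j) := by
    ext
    simp [finProdFinEquiv]
    ring
  simp only [entryStmts, List.getElem_ofFn, this, Equiv.symm_apply_apply]

theorem mem_pointsToSet_entryStmts {n : ℕ} (A B : Matrix (Fin n) (Fin n) Bool) (i j : Fin n) :
    (⟨j, by omega⟩ : Fin (4 * n)) ∈ pointsToSet (entryStmts A B) ⟨i, by omega⟩ ↔
      ∃ k, A i k = true ∧ B k j = true := by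
  constructor
  · intro h
    -- An explicit solution bounds the least one from above: row variables get the rows of the
    -- product, inner variables the rows of `B`, and dummies everything, so that zero entries impose
    -- nothing.
    have hsol := h (fun p => {q | (∀ hp : (p : ℕ) < n, ∃ (k : Fin n) (hq : (q : ℕ) < n),
        A ⟨p, hp⟩ k = true ∧ B k ⟨q, hq⟩ = true) ∧
      (∀ hp : n ≤ (p : ℕ) ∧ (p : ℕ) < 2 * n, ∃ hq : (q : ℕ) < n,
        B ⟨p - n, by omega⟩ ⟨q, hq⟩ = true)}) ?_
    · obtain ⟨k, _, hA, hB⟩ := hsol.1 i.2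
      exact ⟨k, hA, hB⟩
    intro S hS
    obtain ⟨r, c, rfl⟩ := mem_entryStmts.1 hS
    by_cases hr : (r : ℕ) < n
    · rw [entryStmt, dif_pos hr]
      rintro q ⟨-, hq⟩
      obtain ⟨hqn, hB⟩ := hq (by simp; omega)
      simp only [Nat.add_sub_cancel, Fin.eta] at hB
      by_cases hA : A ⟨r, hr⟩ c = true
      · simp only [hA, if_true]
        exact ⟨fun hp => ⟨c, hqn, hA, hB⟩, fun hp => by omega⟩
      · simp only [hA]
        exact ⟨fun hp => by simp at hp; omega, fun hp => by simp at hp⟩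
    · rw [entryStmt, dif_neg hr]
      by_cases hB : B ⟨r - n, by omega⟩ c = true
      · simp only [hB, if_true]
        exact ⟨fun hp => absurd hp hr, fun hp => ⟨c.2, hB⟩⟩
      · simp only [hB]
        exact ⟨fun hp => by simp at hp; omega, fun hp => by simp at hp⟩
  · rintro ⟨k, hA, hB⟩ pt hpt
    have h1 := hpt _ (mem_entryStmts.2 ⟨⟨i, by omega⟩, k, rfl⟩)
    have h2 := hpt _ (mem_entryStmts.2 ⟨⟨k + n, by omega⟩, j, rfl⟩)
    simp only [entryStmt, i.2, dite_true, hA, Fin.eta, if_true, Stmt.Constraint] at h1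
    simp only [entryStmt, Nat.add_sub_cancel, Fin.eta, hB, if_true, Stmt.Constraint,
      show ¬(k : ℕ) + n < n by omega, dite_false] at h2
    exact h1 h2

theorem encodeSpec_initState {n : ℕ} (A B : Matrix (Fin n) (Fin n) Bool) :
    EncodeSpec (initState (boolMatMul.input ⟨n, A, B⟩)) n
      (initState (pointsToAnalysis.input ⟨4 * n, entryStmts A B, entryStmts_nodup A B⟩)).mem := by
  have hmul : ∀ r < 2 * n, ∀ j < n, r * n + j < 2 * n ^ 2 := fun r hr j hj => by
    have := cell_lt hr hj
    rwa [mul_assoc, ← pow_two] at this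
  have hcell : ∀ r < 2 * n, ∀ j < n, ∀ k < 3,
      (initState (pointsToAnalysis.input ⟨4 * n, entryStmts A B, entryStmts_nodup A B⟩)).mem
        (3 * (r * n + j) + k + 2) =
      ((entryStmts A B).flatMap Stmt.encode).getD (3 * (r * n + j) + k) 0 := fun r _ j _ k _ => by
    simp [initState, pointsToAnalysis]
  have hstmt : ∀ (r : ℕ) (hr : r < 2 * n) (j : ℕ) (hj : j < n), ∀ k < 3,
      (initState (pointsToAnalysis.input ⟨4 * n, entryStmts A B, entryStmts_nodup A B⟩)).mem
        (3 * (r * n + j) + k + 2) = (entryStmt A B ⟨r, hr⟩ ⟨j, hj⟩).encode.getD k 0 := by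
    intro r hr j hj k hk
    rw [hcell r hr j hj k hk, getD_flatMap_encode _ _ _ (by
      rw [entryStmts_length]; exact hmul r hr j hj) hk]
    rw [entryStmts_getElem A B ⟨r, hr⟩ ⟨j, hj⟩]
  have hin : ∀ (r : ℕ) (hr : r < 2 * n) (j : ℕ) (hj : j < n),
      (initState (boolMatMul.input ⟨n, A, B⟩)).mem (r * n + j + 2) =
        if h : r < n then (if A ⟨r, h⟩ ⟨j, hj⟩ = true then 1 else 0)
        else if B ⟨r - n, by omega⟩ ⟨j, hj⟩ = true then 1 else 0 := by
    intro r hr j hj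
    have hlist : (initState (boolMatMul.input ⟨n, A, B⟩)).mem (r * n + j + 2) =
        (table (fun i j => A i j = true) ++ table (fun i j => B i j = true)).getD (r * n + j) 0 := by
      simp [initState, boolMatMul]
    rw [hlist]
    -- Supplies the nonlinear part of the offset of `B`'s table to `omega`.
    have hsum : (r - n) * n + n * n = r * n ∨ r < n := by
      rcases lt_or_ge r n with h | h
      · exact .inr h
      · rw [← Nat.add_mul, Nat.sub_add_cancel h]
        exact .inl rfl
    split_ifs with h hA hB
    · rw [List.getD_append _ _ _ _ (by rw [table_length]; exact cell_lt h hj),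
        table_getD _ r j h hj, if_pos hA]
    · rw [List.getD_append _ _ _ _ (by rw [table_length]; exact cell_lt h hj),
        table_getD _ r j h hj, if_neg hA]
    all_goals
      have hidx : r * n + j - n * n = (r - n) * n + j := by omega
      rw [List.getD_append_right _ _ _ _ (by rw [table_length]; omega), table_length, hidx,
        table_getD _ (r - n) j (by omega) hj]
    · rw [if_pos hB]
    · rw [if_neg hB]
  constructor
  · simp [initState, boolMatMul, table_length]
    ring
  · simp [initState, boolMatMul]
  · exact fun _ _ => rfl
  · simp only [initState, pointsToAnalysis, if_true, List.length_cons, length_flatMap_encode,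
      entryStmts_length]
    ring
  · simp [initState, pointsToAnalysis]
  · intro a ha
    obtain ⟨b, rfl⟩ : ∃ b, a = b + 1 := ⟨a - 1, by omega⟩
    simp only [initState, Nat.add_sub_cancel, Nat.add_eq_zero_iff, one_ne_zero, and_false, if_false]
    rw [List.getD_eq_default, List.getD_eq_default]
    · simp only [pointsToAnalysis, List.length_cons, length_flatMap_encode, entryStmts_length]
      omega
    · simp [boolMatMul, table_length]
      nlinarith
  · intro r hr j hj
    rw [hstmt r hr j hj 0 (by norm_num)]
    unfold entryStmt
    split_ifs <;> simp [Stmt.encode]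
  · intro r hr j hj
    rw [hstmt r hr j hj 1 (by norm_num), hin r hr j hj]
    unfold entryStmt
    split_ifs <;> simp_all [Stmt.encode]
  · intro r hr j hj
    rw [hstmt r hr j hj 2 (by norm_num)]
    unfold entryStmt
    split_ifs <;> simp [Stmt.encode]

theorem holds_extractBlock {n : ℕ} {A B : Matrix (Fin n) (Fin n) Bool} {s s' : State}
    (hs : Holds s.mem (pointsToAnalysis.output ⟨4 * n, entryStmts A B, entryStmts_nodup A B⟩))
    (h : ∀ m, s.mem 0 = 16 * m ^ 2 → s'.mem 0 = m ^ 2 ∧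
      ∀ i < m, ∀ j < m, s'.mem (i * m + j + 1) = s.mem (i * (4 * m) + j + 1)) :
    Holds s'.mem (boolMatMul.output ⟨n, A, B⟩) := by
  obtain ⟨hl, hc⟩ := hs
  have hlen : s.mem 0 = 16 * n ^ 2 := by
    refine (hl.trans (table_length _)).trans ?_
    change 4 * n * (4 * n) = _
    ring
  obtain ⟨h0, hcell⟩ := h n hlen
  refine ⟨?_, fun e he => ?_⟩
  · exact (h0.trans (pow_two n)).trans (table_length _).symm
  have he' : e < n * n := he.trans_eq (table_length _)
  have hn : 0 < n := Nat.pos_of_ne_zero fun h => by simp [h] at he'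
  have hi : e / n < n := Nat.div_lt_of_lt_mul he'
  have hj : e % n < n := Nat.mod_lt _ hn
  have hidx : e / n * n + e % n = e := Nat.div_add_mod' e n
  have hlt : e / n * (4 * n) + e % n <
      (pointsToAnalysis.output ⟨4 * n, entryStmts A B, entryStmts_nodup A B⟩).length :=
    (cell_lt (by omega) (by omega)).trans_eq (table_length _).symm
  have hcell' := hcell _ hi _ hj
  rw [hidx, hc _ hlt] at hcell'
  rw [hcell', ← List.getD_eq_getElem _ 0 hlt, ← List.getD_eq_getElem _ 0 he]
  conv_rhs => rw [← hidx]
  simp only [pointsToAnalysis, boolMatMul]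
  rw [table_getD _ _ _ (by omega) (by omega), table_getD _ _ _ hi hj]
  simp only [boolMul, decide_eq_true_eq]
  have := mem_pointsToSet_entryStmts A B ⟨e / n, hi⟩ ⟨e % n, hj⟩
  simp only at this
  simp only [this]

/-! ### Word length and running time -/

theorem initState_mem_lt {n : ℕ} (A B : Matrix (Fin n) (Fin n) Bool) (a : ℕ) :
    (initState (boolMatMul.input ⟨n, A, B⟩)).mem a < 2 * n ^ 2 + 2 := by
  have hn : n ≤ n ^ 2 := Nat.le_self_pow two_ne_zero n
  have hle : ∀ x ∈ boolMatMul.input ⟨n, A, B⟩, x ≤ n + 1 := by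
    intro x hx
    simp only [boolMatMul, List.mem_cons, List.mem_append, table_eq_ofFn, List.mem_ofFn] at hx
    rcases hx with rfl | ⟨e, rfl⟩ | ⟨e, rfl⟩
    · omega
    · split_ifs <;> omega
    · split_ifs <;> omega
  by_cases ha : a = 0
  · have : (boolMatMul.input ⟨n, A, B⟩).length = 2 * n ^ 2 + 1 := by
      simp only [boolMatMul, List.length_cons, List.length_append, table_length]
      ring
    simp only [initState, ha, if_true, this]
    omega
  · simp only [initState, ha, if_false]
    by_cases hlt : a - 1 < (boolMatMul.input ⟨n, A, B⟩).length
    · rw [List.getD_eq_getElem _ _ hlt]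
      have := hle _ (List.getElem_mem hlt)
      omega
    · rw [List.getD_eq_default _ _ (by omega)]
      omega

/-- `W` accommodates the encoder and the points-to algorithm. Extraction needs a larger bound, since
its initial memory is only known to lie below `W`. The summand `m` is there because one constant
must bound both word length and time. -/
theorem exists_word_bound (n c m : ℕ) : ∃ W : ℕ,
    2 ^ (c * (Nat.log 2 (4 * n) + 1)) ≤ W ∧ 64 * (2 * n ^ 2 + 2 + 1) ≤ W ∧
      64 * (W + 1) ≤ 2 ^ ((m + 3 * c + 20) * (Nat.log 2 n + 1)) := by
  have hn : n < 2 ^ (Nat.log 2 n + 1) := Nat.lt_pow_succ_log_self (by norm_num) n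
  have hlog : Nat.log 2 (4 * n) < Nat.log 2 n + 1 + 2 := by
    refine Nat.log_lt_of_lt_pow' (by omega) ?_
    rw [pow_add _ _ 2]
    omega
  have hℓ : 1 ≤ Nat.log 2 n + 1 := Nat.le_add_left _ _
  generalize Nat.log 2 n + 1 = ℓ at *
  generalize Nat.log 2 (4 * n) = ℓ' at *
  refine ⟨2 ^ (c * (3 * ℓ) + 10 * ℓ), ?_, ?_, ?_⟩
  · refine Nat.pow_le_pow_right (by norm_num) ?_
    have := Nat.mul_le_mul_left c (show ℓ' + 1 ≤ 3 * ℓ by omega)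
    omega
  · calc 64 * (2 * n ^ 2 + 2 + 1) ≤ (n ^ 2 + 1) * 2 ^ 8 := by omega
      _ ≤ 2 ^ (ℓ * 2) * 2 ^ 8 := by
        rw [pow_mul]
        exact Nat.mul_le_mul_right _ (Nat.pow_lt_pow_left hn two_ne_zero)
      _ ≤ _ := by
        rw [← pow_add]
        exact Nat.pow_le_pow_right (by norm_num) (by omega)
  · have h1 := Nat.one_le_two_pow (n := c * (3 * ℓ) + 10 * ℓ)
    calc 64 * (2 ^ (c * (3 * ℓ) + 10 * ℓ) + 1) ≤ 2 ^ (c * (3 * ℓ) + 10 * ℓ) * 2 ^ 7 := by omega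
      _ ≤ _ := by
        rw [← pow_add]
        refine Nat.pow_le_pow_right (by norm_num) ?_
        have : (m + 3 * c + 20) * ℓ = m * ℓ + (c * (3 * ℓ) + 20 * ℓ) := by ring
        rw [this]
        omega

theorem time_bound {n c m t1 t2 t3 : ℕ} {e ε : ℝ} (he : e ≤ ε) (hε : 2 ≤ ε)
    (hm : (c : ℝ) * 4 ^ ε + 2048 ≤ m) (h1 : t1 ≤ 64 * (2 * n ^ 2 + 1 + 1))
    (h2 : (t2 : ℝ) ≤ c * (((4 * n : ℕ) : ℝ) + 1) ^ e) (h3 : t3 ≤ 64 * (16 * n ^ 2 + 1)) :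
    ((t1 + t2 + t3 : ℕ) : ℝ) ≤ m * ((n : ℝ) + 1) ^ ε := by
  have hn : (0 : ℝ) ≤ n := Nat.cast_nonneg n
  have hsq : ((n : ℝ) + 1) ^ 2 ≤ ((n : ℝ) + 1) ^ ε := by
    rw [← Real.rpow_two]
    exact Real.rpow_le_rpow_of_exponent_le (by linarith) hε
  have hpow : (((4 * n : ℕ) : ℝ) + 1) ^ e ≤ 4 ^ ε * ((n : ℝ) + 1) ^ ε := by
    rw [← Real.mul_rpow (by norm_num) (by linarith)]
    push_cast
    calc (4 * (n : ℝ) + 1) ^ e ≤ (4 * (n : ℝ) + 1) ^ ε :=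
          Real.rpow_le_rpow_of_exponent_le (by linarith) he
      _ ≤ (4 * ((n : ℝ) + 1)) ^ ε :=
          Real.rpow_le_rpow (by linarith) (by linarith) (by linarith)
  have h13 : ((t1 : ℝ) + t3) ≤ 2048 * ((n : ℝ) + 1) ^ 2 := by
    have : t1 + t3 ≤ 2048 * (n + 1) ^ 2 := by
      have : (n + 1) ^ 2 = n ^ 2 + 2 * n + 1 := by ring
      omega
    exact_mod_cast this
  have h2' := h2.trans (mul_le_mul_of_nonneg_left hpow (Nat.cast_nonneg c))
  calc ((t1 + t2 + t3 : ℕ) : ℝ) = (t1 + t3 : ℝ) + t2 := by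
        push_cast
        ring
    _ ≤ 2048 * ((n : ℝ) + 1) ^ ε + c * (4 ^ ε * ((n : ℝ) + 1) ^ ε) := by
        linarith
    _ = (c * 4 ^ ε + 2048) * ((n : ℝ) + 1) ^ ε := by ring
    _ ≤ _ := mul_le_mul_of_nonneg_right hm (Real.rpow_nonneg (by linarith) _)

/-- The reduction from Boolean matrix multiplication to points-to analysis. -/
theorem SolvesInTime.boolMatMul_of_pointsToAnalysis {A : Program} {e ε : ℝ}
    (hA : SolvesInTime A pointsToAnalysis e) (he : e ≤ ε) (hε : 2 ≤ ε) :
    SolvesInTime (.seq (.seq encodeMatrices A) extractBlock) boolMatMul ε := by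
  obtain ⟨c, hc⟩ := hA
  obtain ⟨m, hm⟩ : ∃ m : ℕ, (c : ℝ) * 4 ^ ε + 2048 ≤ m := exists_nat_ge _
  refine ⟨m + 3 * c + 20, fun ⟨n, M, N⟩ => ?_⟩
  obtain ⟨s2, t2, h2, ht2, hs2⟩ := hc ⟨4 * n, entryStmts M N, entryStmts_nodup M N⟩
  obtain ⟨W, hWA, hWE, hW⟩ := exists_word_bound n c m
  have hle : W ≤ 2 ^ ((m + 3 * c + 20) * (Nat.log 2 n + 1)) := by omega
  have hmem := initState_mem_lt M N
  have hspec := encodeSpec_initState M N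
  obtain ⟨s1, t1, h1, ht1, -, hs1⟩ := reaches_encodeMatrices hmem hWE
  have hm1 : ∀ a, s1.mem a < W := h1.mem_lt fun a => (hmem a).trans_le (by omega)
  -- The algorithm is only guaranteed to run from `initState`; the encoder ends exactly there, with
  -- all registers cleared.
  replace h2 : Exec W A s1 s2 t2 := by
    rw [hs1 n _ hspec]
    exact h2.mono hWA
  obtain ⟨s3, t3, h3, ht3, -, hs3⟩ := reaches_extractBlock (h2.mem_lt hm1) hW
  refine ⟨s3, t1 + t2 + t3, .seq (.seq (h1.mono hle) (h2.mono hle)) h3, ?_,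
    holds_extractBlock hs2 hs3⟩
  have hlen : s2.mem 0 = 16 * n ^ 2 := by
    refine (hs2.1.trans (table_length _)).trans ?_
    change 4 * n * (4 * n) = _
    ring
  rw [hspec.length] at ht1
  rw [hlen] at ht3
  exact time_bound he hε (hm.trans (by exact_mod_cast (by omega))) ht1 ht2 ht3

end PointsToBMM

theorem theorem2 (K : Set PointsToBMM.Program) (δ : ℝ) (hδ : 0 < δ)
    (h : ∃ A : PointsToBMM.Program, PointsToBMM.Combinatorial K A ∧
      PointsToBMM.SolvesInTime A PointsToBMM.pointsToAnalysis (3 - δ)) :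
    ∃ B : PointsToBMM.Program, PointsToBMM.Combinatorial K B ∧
      PointsToBMM.SolvesInTrulySubcubicTime B PointsToBMM.boolMatMul := by
  obtain ⟨A, hK, hA⟩ := h
  -- The minimum with `1` keeps the exponent at least `2`, absorbing the quadratic overhead.
  refine ⟨_, .seq (.seq (.elementary PointsToBMM.encodeMatrices_elementary) hK)
    (.elementary PointsToBMM.extractBlock_elementary), min δ 1, lt_min hδ one_pos,
    hA.boolMatMul_of_pointsToAnalysis ?_ ?_⟩
  · linarith [min_le_left δ 1]
  · linarith [min_le_right δ 1]
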